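/- Consider $N$ nodes and, for $t=1,2,\dots$, directed graphs $\mathcal G_t=(\{1,\dots,N\},\mathcal E_t)$ with $N\times N$ mixing matrices $W_t=(w_{ij,t})$ such that $w_{ij,t}>0$ if $(j,i)\in\mathcal E_t$ or $i=j$, and $w_{ij,t}=0$ otherwise. Write $\mathcal N^{\rm in}_{i,t}=\{j:(j,i)\in\mathcal E_t\}\cup\{i\}$. Assume that there are $a\in(0,1)$ and an integer $B>0$ such that for all $t\ge1$: $w_{ij,t}>a$ whenever $w_{ij,t}>0$; $\sum_{i=1}^N w_{ij,t}=1$ for all $j$; and for every integer $k\ge 0$ the directed graph with edge set $\bigcup_{t=kB+1}^{(k+1)B}\mathcal E_t$ is strongly connected. For each node $i$ let $X_i\subset\mathbb R^{d_i}$ be a compact convex set, and let $f_{i,t}:\mathbb R^{d_i}\to\mathbb R$ ($t\ge1$) and (componentwise) $g_i:\mathbb R^{d_i}\to\mathbb R^p$ be convex on $X_i$. Let $\partial f_{i,t}(x)$, $x\in X_i$, denote a chosen subgradient, i.e. $f_{i,t}(y)\ge f_{i,t}(x)+\langle\partial f_{i,t}(x),y-x\rangle$ for all $y\in X_i$. Let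 $F,G>0$ and $R$ be constants, independent of $i$ and $t$, such that $\operatorname{diam}X_i\le R$, $\|g_i(x)\|\le F$ and $\|\partial f_{i,t}(x)\|\le G$ for all $i$, all $t\ge1$ and all $x\in X_i$. Let $\mathcal X=\{(x_1,\dots,x_N)\in X_1\times\dots\times X_N:\sum_{i=1}^N g_i(x_i)\le \mathbf 0\}$ and let $\mathbf x_t^*=(x_{1,t}^*,\dots,x_{N,t}^*)\in\operatorname{arg\,min}_{\mathbf x\in\mathcal X}\sum_{i=1}^N f_{i,t}(x_i)$ for each $t\ge1$ (any choice of minimizers). The algorithm DUST with $\alpha_t=\sqrt t$ and $\eta_t=t$ starts from any $x_{i,1}\in X_i$, $y_{i,1}=g_i(x_{i,1})$, $c_{i,1}=1$, $\mu_{i,1}=\mathbf 0$ and for $t\ge 1$ sets \begin{align*} c_{i,t+1}&=\sum_{j\in\mathcal N^{\rm in}_{i,t}}w_{ij,t}c_{j,t},\qquad \lambda_{i,t+1}=\frac{1}{c_{i,t+1}}\sum_{j\in\mathcal N^{\rm in}_{i,t}}w_{ij,t}\mu_{j,t},\\ x_{i,t+1}&=\operatorname*{arg\,min}_{x\in X_i}\left\{\alpha_t\langle\partial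 f_{i,t}(x_{i,t}),x-x_{i,t}\rangle+\langle\lambda_{i,t+1},g_i(x)\rangle+\eta_t\|x-x_{i,t}\|^2\right\},\\ y_{i,t+1}&=\sum_{j\in\mathcal N^{\rm in}_{i,t}}w_{ij,t}y_{j,t}+g_i(x_{i,t+1})-g_i(x_{i,t}),\\ \mu_{i,t+1}&=\Big[\sum_{j\in\mathcal N^{\rm in}_{i,t}}w_{ij,t}\mu_{j,t}+y_{i,t+1}\Big]_+ , \end{align*} where $[\cdot]_+$ is the componentwise positive part. Then there are constants $C_1,C_2$ depending only on $N,p,a,B,F,G,R$ such that for every $T\ge1$ $$\operatorname{Reg}(T):=\sum_{t=1}^T\sum_{i=1}^N f_{i,t}(x_{i,t})-\sum_{t=1}^T\sum_{i=1}^N f_{i,t}(x_{i,t}^*)\ \le\ C_1\sqrt T+C_2V_T,\qquad V_T:=\sum_{t=1}^T\sqrt t\sum_{i=1}^N\|x_{i,t+1}^*-x_{i,t}^*\|,$$ i.e. $\operatorname{Reg}(T)=\mathcal O(\sqrt T)+\mathcal O(V_T)$. -/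

import Mathlib

open scoped BigOperators

namespace DUST

noncomputable section

/-! ### Time-varying network -/

/-- The in-neighbours of node `i` in a directed graph, node `i` itself included.
`Γ.Adj j i` means that `i` can receive a message from `j`. -/
def inNeighbors {N : ℕ} (Γ : Digraph (Fin N)) (i : Fin N) : Finset (Fin N) :=
  open Classical in Finset.univ.filter fun j => Γ.Adj j i ∨ j = i

/-- `W` is a mixing matrix associated with the directed graph `Γ`: the weight `W i j` is
positive if `(j, i)` is an edge or `i = j`, and zero otherwise. -/
def IsMixingMatrix {N : ℕ} (Γ : Digraph (Fin N)) (W : Matrix (Fin N) (Fin N) ℝ) : Prop :=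
  ∀ i j, ((Γ.Adj j i ∨ i = j) → 0 < W i j) ∧ (¬ (Γ.Adj j i ∨ i = j) → W i j = 0)

/-- The union of the edge sets of the graphs `Γ t`, `k B + 1 ≤ t ≤ (k + 1) B`. -/
def windowUnion {N : ℕ} (Γ : ℕ → Digraph (Fin N)) (B k : ℕ) : Digraph (Fin N) where
  Adj i j := ∃ t ∈ Finset.Icc (k * B + 1) ((k + 1) * B), (Γ t).Adj i j

/-- Every node can be reached from every node along a directed path. -/
def StronglyConnected {N : ℕ} (Γ : Digraph (Fin N)) : Prop :=
  ∀ i j, Relation.ReflTransGen Γ.Adj i j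

/-- The standing conditions on the network; times are `t = 1, 2, …`. -/
structure NetworkAssumption {N : ℕ} (Γ : ℕ → Digraph (Fin N))
    (W : ℕ → Matrix (Fin N) (Fin N) ℝ) (a : ℝ) (B : ℕ) : Prop where
  mixing : ∀ t, 1 ≤ t → IsMixingMatrix (Γ t) (W t)
  nondegenerate : ∀ t, 1 ≤ t → ∀ i j, 0 < W t i j → a < W t i j
  columnStochastic : ∀ t, 1 ≤ t → ∀ j, ∑ i, W t i j = 1
  jointlyConnected : ∀ k, StronglyConnected (windowUnion Γ B k)

/-! ### The online problem -/

/-- The data of the online problem: constraint sets, local costs `f t i` at time `t`, and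
local constraint functions with values in `ℝᵖ`. -/
structure Problem (N p : ℕ) where
  d : Fin N → ℕ
  X : (i : Fin N) → Set (EuclideanSpace ℝ (Fin (d i)))
  f : ℕ → (i : Fin N) → EuclideanSpace ℝ (Fin (d i)) → ℝ
  g : (i : Fin N) → EuclideanSpace ℝ (Fin (d i)) → EuclideanSpace ℝ (Fin p)

/-- The joint decisions `(x₁, …, x_N)`. -/
abbrev Problem.Decision {N p : ℕ} (P : Problem N p) : Type :=
  (i : Fin N) → EuclideanSpace ℝ (Fin (P.d i))

/-- The feasible set: `x_i ∈ X_i` for all `i` and `∑ g_i(x_i) ≤ 0` componentwise. -/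
def Problem.feasible {N p : ℕ} (P : Problem N p) : Set P.Decision :=
  {x | (∀ i, x i ∈ P.X i) ∧ ∀ k : Fin p, ∑ i, P.g i (x i) k ≤ 0}

/-- The global cost at time `t`. -/
def Problem.cost {N p : ℕ} (P : Problem N p) (t : ℕ) (x : P.Decision) : ℝ :=
  ∑ i, P.f t i (x i)

/-- `xs t` is an optimal solution of the problem at each time `t ≥ 1`. -/
def Problem.IsOptimalSequence {N p : ℕ} (P : Problem N p) (xs : ℕ → P.Decision) : Prop :=
  ∀ t, 1 ≤ t → xs t ∈ P.feasible ∧ IsMinOn (P.cost t) P.feasible (xs t)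

/-- `v` is a subgradient of `f` at `x`, relative to the set `S`. -/
def IsSubgradientOn {n : ℕ} (S : Set (EuclideanSpace ℝ (Fin n)))
    (f : EuclideanSpace ℝ (Fin n) → ℝ) (x v : EuclideanSpace ℝ (Fin n)) : Prop :=
  ∀ y ∈ S, f x + inner ℝ v (y - x) ≤ f y

/-- The standing conditions on the problem: compact convex constraint sets and convex costs and
constraint functions (componentwise for the latter). -/
structure ProblemAssumption {N p : ℕ} (P : Problem N p) : Prop where
  compact : ∀ i, IsCompact (P.X i)
  convex : ∀ i, Convex ℝ (P.X i)
  convex_f : ∀ t, 1 ≤ t → ∀ i, ConvexOn ℝ (P.X i) (P.f t i)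
  convex_g : ∀ i, ∀ k : Fin p, ConvexOn ℝ (P.X i) fun x => P.g i x k

/-- The constants of the problem: `R` bounds the diameters of the `X_i`, `F` bounds the
constraint functions on them, and `G` bounds, uniformly in time, the subgradients
`∂f t i x` of the costs at the points `x` of `X_i`. -/
structure ProblemBounds {N p : ℕ} (P : Problem N p)
    (df : ℕ → (i : Fin N) → EuclideanSpace ℝ (Fin (P.d i)) → EuclideanSpace ℝ (Fin (P.d i)))
    (F G R : ℝ) : Prop where
  diam_le : ∀ i, Metric.diam (P.X i) ≤ R
  norm_g_le : ∀ i, ∀ x ∈ P.X i, ‖P.g i x‖ ≤ F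
  subgradient : ∀ t, 1 ≤ t → ∀ i, ∀ x ∈ P.X i, IsSubgradientOn (P.X i) (P.f t i) x (df t i x)
  norm_df_le : ∀ t, 1 ≤ t → ∀ i, ∀ x ∈ P.X i, ‖df t i x‖ ≤ G

/-! ### The algorithm -/

/-- Componentwise projection onto the nonnegative orthant. -/
def projNonneg {p : ℕ} (v : EuclideanSpace ℝ (Fin p)) : EuclideanSpace ℝ (Fin p) :=
  WithLp.toLp 2 fun k => max (v k) 0

/-- The sequences `c, lam, x, y, μ` (times `t = 1, 2, …`) are generated by the distributed dual
subgradient tracking algorithm with parameters `α`, `η` and subgradient choice `df`. -/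
structure IsRun {N p : ℕ} (P : Problem N p) (Γ : ℕ → Digraph (Fin N))
    (W : ℕ → Matrix (Fin N) (Fin N) ℝ)
    (df : ℕ → (i : Fin N) → EuclideanSpace ℝ (Fin (P.d i)) → EuclideanSpace ℝ (Fin (P.d i)))
    (α η : ℕ → ℝ)
    (c : ℕ → Fin N → ℝ) (lam : ℕ → Fin N → EuclideanSpace ℝ (Fin p))
    (x : ℕ → P.Decision) (y μ : ℕ → Fin N → EuclideanSpace ℝ (Fin p)) : Prop where
  init_x : ∀ i, x 1 i ∈ P.X i
  init_c : ∀ i, c 1 i = 1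
  init_μ : ∀ i, μ 1 i = 0
  init_y : ∀ i, y 1 i = P.g i (x 1 i)
  step_c : ∀ t, 1 ≤ t → ∀ i, c (t + 1) i = ∑ j ∈ inNeighbors (Γ t) i, W t i j * c t j
  step_lam : ∀ t, 1 ≤ t → ∀ i,
    lam (t + 1) i = (c (t + 1) i)⁻¹ • ∑ j ∈ inNeighbors (Γ t) i, W t i j • μ t j
  step_x_mem : ∀ t, 1 ≤ t → ∀ i, x (t + 1) i ∈ P.X i
  step_x_min : ∀ t, 1 ≤ t → ∀ i,
    IsMinOn (fun z => α t * inner ℝ (df t i (x t i)) (z - x t i)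
        + inner ℝ (lam (t + 1) i) (P.g i z) + η t * ‖z - x t i‖ ^ 2)
      (P.X i) (x (t + 1) i)
  step_y : ∀ t, 1 ≤ t → ∀ i,
    y (t + 1) i = ∑ j ∈ inNeighbors (Γ t) i, W t i j • y t j
      + P.g i (x (t + 1) i) - P.g i (x t i)
  step_μ : ∀ t, 1 ≤ t → ∀ i,
    μ (t + 1) i = projNonneg (∑ j ∈ inNeighbors (Γ t) i, W t i j • μ t j + y (t + 1) i)

/-! ### Performance measures -/

/-- The dynamic regret up to time `T` of the decisions `x` against the decisions `xs`. -/
def dynamicRegret {N p : ℕ} (P : Problem N p) (x xs : ℕ → P.Decision) (T : ℕ) : ℝ :=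
  ∑ t ∈ Finset.Icc 1 T, ∑ i, P.f t i (x t i) - ∑ t ∈ Finset.Icc 1 T, ∑ i, P.f t i (xs t i)

/-- The accumulated variation `V_T` of the sequence `xs`. -/
def variation {N p : ℕ} (P : Problem N p) (xs : ℕ → P.Decision) (T : ℕ) : ℝ :=
  ∑ t ∈ Finset.Icc 1 T, Real.sqrt t * ∑ i, ‖xs (t + 1) i - xs t i‖

end

end DUST

/-!
Regret of distributed dual subgradient tracking, by a drift-plus-penalty argument.

*Network.* The product of `mixTime N B` consecutive mixing matrices has all entries at least
`weightFloor N a B > 0` (`weightFloor_le_transition`): in each window the set of nodes reached from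
a given node grows until it is everything. Hence the push-sum weights `c` are bounded below, and
the ratios `z / c` of a sequence `z` with `z (t + 1) = W t * z t + O(1)` stay within a bounded
distance of each other, since every `mixTime N B` steps their spread is contracted by a fixed
factor (`IsPushSumWeight.norm_ratio_sub_ratio_le_disagreementBound`). Applied to `y`, whose sum is
`∑ g_i (x_i)`, this bounds `y` (`IsRun.norm_y_le`); applied to `μ`, which `y` perturbs by at most
`‖y‖`, it bounds the disagreement of the local multipliers (`IsRun.norm_lam_sub_lam_le`). The
multipliers themselves may be unbounded; only their differences matter.

*Dual drift.* The potential `Φ_t = ∑ ‖μ_i‖ ^ 2 / c_i` does not increase under mixing, by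
Cauchy–Schwarz, so that `Φ_{t+1} ≤ Φ_t + 2 ∑ ⟪lam_i, y_i⟫ + O(1)` (`IsRun.potential_succ_le`). As
`∑ y_i = ∑ g_i (x_i)` and the multipliers differ by `O(1)`, each `y_i` may be replaced by
`g_i (x_i)`, and for feasible `u` the sum `∑ ⟪lam_i, g_i (u_i)⟫` is at most a constant.

*Primal step.* The local subproblem is strongly convex, and the choice of `√t` and `t` makes the
linear term cost only `G ^ 2 / 4`. Together these give (`IsRun.sqrt_mul_regret_le`), for the optimal
`u = x*_t`,
`√t * (f_t (x_t) - f_t (u)) ≤ (Φ_t - Φ_{t+1}) / 2 + K + t * (‖u - x_t‖ ^ 2 - ‖u - x_{t+1}‖ ^ 2)`.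

*Summation.* After division by `√t`, the potential terms sum to at most `Φ_1 / 2 = 0`, the constants
to `2 * K * √T`, and the distances to `N * R ^ 2 * √T` plus the cost `2 * R * V_T` of moving the
reference point from `x*_t` to `x*_{t+1}`.
-/

namespace DUST

/-! ### Products of mixing matrices -/

section Network

variable {N : ℕ} {Γ : ℕ → Digraph (Fin N)} {W : ℕ → Matrix (Fin N) (Fin N) ℝ} {a : ℝ} {B : ℕ}

theorem IsMixingMatrix.nonneg {Γ : Digraph (Fin N)} {W : Matrix (Fin N) (Fin N) ℝ}
    (h : IsMixingMatrix Γ W) (i j : Fin N) : 0 ≤ W i j := by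
  by_cases hij : Γ.Adj j i ∨ i = j
  · exact ((h i j).1 hij).le
  · exact ((h i j).2 hij).ge

/-- Since the weights vanish off the in-neighbourhood, sums over in-neighbours are full
matrix-vector products. -/
theorem IsMixingMatrix.sum_inNeighbors {Γ : Digraph (Fin N)} {W : Matrix (Fin N) (Fin N) ℝ}
    (h : IsMixingMatrix Γ W) {E : Type*} [AddCommGroup E] [Module ℝ E] (i : Fin N)
    (z : Fin N → E) : ∑ j ∈ inNeighbors Γ i, W i j • z j = ∑ j, W i j • z j := by
  refine Finset.sum_subset (Finset.subset_univ _) fun j _ hj => ?_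
  have hj' : ¬ (Γ.Adj j i ∨ i = j) := by
    simpa [inNeighbors, eq_comm] using hj
  rw [(h i j).2 hj', zero_smul]

/-- The product `W (s + n - 1) * ⋯ * W s` of the `n` mixing matrices used from time `s` on. -/
def transition (W : ℕ → Matrix (Fin N) (Fin N) ℝ) (s : ℕ) : ℕ → Matrix (Fin N) (Fin N) ℝ
  | 0 => 1
  | n + 1 => W (s + n) * transition W s n

/-- A number of steps after which information has travelled between any two nodes. The extra
window of length `B` accounts for start times that are not aligned with the windows. -/
def mixTime (N B : ℕ) : ℕ := (N + 1) * B

/-- The uniform lower bound `a ^ mixTime N B` for the entries of the products of `mixTime N B`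
consecutive mixing matrices, and for the push-sum weights. -/
def weightFloor (N : ℕ) (a : ℝ) (B : ℕ) : ℝ := a ^ mixTime N B

theorem weightFloor_pos (ha : a ∈ Set.Ioo (0 : ℝ) 1) : 0 < weightFloor N a B :=
  pow_pos ha.1 _

theorem transition_succ_apply (s n : ℕ) (i j : Fin N) :
    transition W s (n + 1) i j = ∑ k, W (s + n) i k * transition W s n k j := rfl

theorem transition_nonneg (h : NetworkAssumption Γ W a B) {s : ℕ} (hs : 1 ≤ s) (n : ℕ)
    (i j : Fin N) : 0 ≤ transition W s n i j := by
  induction n generalizing i with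
  | zero =>
    simp only [transition, Matrix.one_apply]
    split_ifs <;> norm_num
  | succ n ih =>
    rw [transition_succ_apply]
    exact Finset.sum_nonneg fun k _ =>
      mul_nonneg ((h.mixing (s + n) (by omega)).nonneg i k) (ih k)

/-- If `j` influences `i` within `n` steps with weight at least `a ^ n`, then it influences the
out-neighbours of `i` at the next step with weight at least `a ^ (n + 1)`. -/
theorem pow_le_transition_succ (h : NetworkAssumption Γ W a B) (ha : 0 < a) {s : ℕ} (hs : 1 ≤ s)
    {n : ℕ} {i j k : Fin N} (hi : a ^ n ≤ transition W s n i j)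
    (hk : (Γ (s + n)).Adj i k ∨ k = i) : a ^ (n + 1) ≤ transition W s (n + 1) k j := by
  have hm := h.mixing (s + n) (by omega)
  have hw : a < W (s + n) k i := h.nondegenerate _ (by omega) _ _ ((hm k i).1 hk)
  calc a ^ (n + 1) = a * a ^ n := pow_succ' a n
    _ ≤ W (s + n) k i * transition W s n i j :=
      mul_le_mul hw.le hi (pow_pos ha n).le (hm.nonneg k i)
    _ ≤ transition W s (n + 1) k j := by
      rw [transition_succ_apply]
      exact Finset.single_le_sum
        (f := fun l => W (s + n) k l * transition W s n l j)
        (fun l _ => mul_nonneg (hm.nonneg k l) (transition_nonneg h hs n l j)) (Finset.mem_univ i)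

theorem pow_le_transition_of_le (h : NetworkAssumption Γ W a B) (ha : 0 < a) {s : ℕ} (hs : 1 ≤ s)
    {n m : ℕ} (hnm : n ≤ m) {i j : Fin N} (hi : a ^ n ≤ transition W s n i j) :
    a ^ m ≤ transition W s m i j := by
  induction m, hnm using Nat.le_induction with
  | base => exact hi
  | succ m _ ih => exact pow_le_transition_succ h ha hs ih (Or.inr rfl)

theorem pow_le_transition_diag (h : NetworkAssumption Γ W a B) (ha : 0 < a) {s : ℕ} (hs : 1 ≤ s)
    (n : ℕ) (i : Fin N) : a ^ n ≤ transition W s n i i :=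
  pow_le_transition_of_le h ha hs (Nat.zero_le n) (by simp [transition])

/-- The nodes that `j` influences within `n` steps from time `s` with weight at least `a ^ n`. -/
noncomputable def reached (W : ℕ → Matrix (Fin N) (Fin N) ℝ) (a : ℝ) (s : ℕ) (j : Fin N) (n : ℕ) :
    Finset (Fin N) :=
  open Classical in Finset.univ.filter fun i => a ^ n ≤ transition W s n i j

theorem mem_reached {s n : ℕ} {i j : Fin N} :
    i ∈ reached W a s j n ↔ a ^ n ≤ transition W s n i j := by
  simp [reached]

theorem reached_mono (h : NetworkAssumption Γ W a B) (ha : 0 < a) {s : ℕ} (hs : 1 ≤ s)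
    (j : Fin N) : Monotone (reached W a s j) := fun _ _ hnm _ hi =>
  mem_reached.2 (pow_le_transition_of_le h ha hs hnm (mem_reached.1 hi))

/-- Over a full window the reached set grows unless it is already everything: otherwise it would
be closed under the edges of a strongly connected graph. -/
theorem reached_window (h : NetworkAssumption Γ W a B) (ha : 0 < a) {s : ℕ} (hs : 1 ≤ s)
    (j : Fin N) {n k : ℕ} (hn : s + n = k * B + 1) :
    reached W a s j n = Finset.univ ∨
      (reached W a s j n).card < (reached W a s j (n + B)).card := by
  by_cases hsub : reached W a s j (n + B) ⊆ reached W a s j n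
  · left
    have hclosed : ∀ i, Relation.ReflTransGen (windowUnion Γ B k).Adj j i →
        i ∈ reached W a s j n := by
      intro i hi
      induction hi with
      | refl => exact mem_reached.2 (pow_le_transition_diag h ha hs n j)
      | tail _ hadj ih =>
        obtain ⟨t, ht, hadj⟩ := hadj
        obtain ⟨m, rfl⟩ := Nat.exists_eq_add_of_le (hn ▸ (Finset.mem_Icc.1 ht).1)
        have hm : n + m + 1 ≤ n + B := by
          have := (Finset.mem_Icc.1 ht).2
          rw [Nat.add_mul, one_mul] at this
          omega
        rw [add_assoc] at hadj
        exact hsub (reached_mono h ha hs j hm (mem_reached.2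
          (pow_le_transition_succ h ha hs
            (mem_reached.1 (reached_mono h ha hs j (Nat.le_add_right n m) ih)) (Or.inl hadj))))
    exact Finset.eq_univ_of_forall fun i => hclosed i (h.jointlyConnected k j i)
  · right
    exact Finset.card_lt_card
      ⟨reached_mono h ha hs j (Nat.le_add_right n B), hsub⟩

theorem weightFloor_le_transition (h : NetworkAssumption Γ W a B) (ha : 0 < a) (hB : 0 < B)
    {s : ℕ} (hs : 1 ≤ s) (i j : Fin N) :
    weightFloor N a B ≤ transition W s (mixTime N B) i j := by
  -- the first window boundary after `s`
  obtain ⟨n, hn⟩ : ∃ n, s + n = ((s - 1) / B + 1) * B + 1 := by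
    refine Nat.exists_eq_add_of_le ?_ |>.imp fun n hn => hn.symm
    have h1 := Nat.div_add_mod (s - 1) B
    have h2 := Nat.mod_lt (s - 1) hB
    rw [add_mul, mul_comm ((s - 1) / B) B]
    omega
  have hnB : n ≤ B := by
    have h1 := Nat.div_mul_le_self (s - 1) B
    rw [add_mul] at hn
    omega
  have hcard : ∀ m : ℕ, m ≤ N → m ≤ (reached W a s j (n + m * B)).card := by
    intro m
    induction m with
    | zero => simp
    | succ m ih =>
      intro hm
      have hal : s + (n + m * B) = ((s - 1) / B + 1 + m) * B + 1 := by
        rw [← add_assoc, hn]; ring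
      have heq : n + (m + 1) * B = n + m * B + B := by ring
      rw [heq]
      rcases reached_window h ha hs j hal with huniv | hlt
      · have := Finset.card_le_card (reached_mono h ha hs j (Nat.le_add_right (n + m * B) B))
        rw [huniv, Finset.card_univ, Fintype.card_fin] at this
        omega
      · have := ih (by omega)
        omega
  have huniv : reached W a s j (n + N * B) = Finset.univ := by
    refine Finset.eq_univ_of_card _ (le_antisymm (Finset.card_le_univ _) ?_)
    simpa using hcard N le_rfl
  have hle : n + N * B ≤ mixTime N B := by
    rw [mixTime, add_mul]; omega
  exact mem_reached.1 (reached_mono h ha hs j hle (huniv ▸ Finset.mem_univ i))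

theorem sum_sum_smul_of_columnStochastic {E : Type*} [AddCommGroup E] [Module ℝ E]
    {M : Matrix (Fin N) (Fin N) ℝ} (hM : ∀ j, ∑ i, M i j = 1) (z : Fin N → E) :
    ∑ i, ∑ j, M i j • z j = ∑ j, z j := by
  rw [Finset.sum_comm]
  exact Finset.sum_congr rfl fun j _ => by rw [← Finset.sum_smul, hM, one_smul]

/-! ### Push-sum weights -/

theorem eq_sum_transition (c : ℕ → Fin N → ℝ)
    (hc : ∀ t, 1 ≤ t → ∀ i, c (t + 1) i = ∑ j, W t i j * c t j) {s : ℕ} (hs : 1 ≤ s) (n : ℕ)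
    (i : Fin N) : c (s + n) i = ∑ j, transition W s n i j * c s j := by
  induction n generalizing i with
  | zero => simp [transition, Matrix.one_apply]
  | succ n ih =>
    rw [← add_assoc, hc _ (by omega)]
    simp only [ih, transition_succ_apply, Finset.mul_sum, Finset.sum_mul]
    rw [Finset.sum_comm]
    exact Finset.sum_congr rfl fun j _ => Finset.sum_congr rfl fun k _ => by ring

/-- The push-sum weights: the orbit of the all-ones vector under the mixing matrices. -/
structure IsPushSumWeight (W : ℕ → Matrix (Fin N) (Fin N) ℝ) (c : ℕ → Fin N → ℝ) : Prop where
  one : ∀ i, c 1 i = 1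
  step : ∀ t, 1 ≤ t → ∀ i, c (t + 1) i = ∑ j, W t i j * c t j

namespace IsPushSumWeight

variable {c : ℕ → Fin N → ℝ}

theorem sum_eq (hc : IsPushSumWeight W c) (h : NetworkAssumption Γ W a B) {t : ℕ} (ht : 1 ≤ t) :
    ∑ i, c t i = N := by
  induction t, ht using Nat.le_induction with
  | base => simp [hc.one]
  | succ t ht ih =>
    rw [← ih]
    simp only [hc.step t ht]
    exact sum_sum_smul_of_columnStochastic (h.columnStochastic t ht) (c t)

theorem nonneg (hc : IsPushSumWeight W c) (h : NetworkAssumption Γ W a B) {t : ℕ} (ht : 1 ≤ t)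
    (i : Fin N) : 0 ≤ c t i := by
  induction t, ht using Nat.le_induction generalizing i with
  | base => simp [hc.one]
  | succ t ht ih =>
    rw [hc.step t ht]
    exact Finset.sum_nonneg fun j _ => mul_nonneg ((h.mixing t ht).nonneg i j) (ih j)

theorem weightFloor_le (hc : IsPushSumWeight W c) (h : NetworkAssumption Γ W a B)
    (ha : a ∈ Set.Ioo (0 : ℝ) 1) (hB : 0 < B) {t : ℕ} (ht : 1 ≤ t) (i : Fin N) :
    weightFloor N a B ≤ c t i := by
  rcases le_or_gt t (mixTime N B) with htL | htL
  · -- early times: the self-loops retain a share `a ^ (t - 1)` of the initial weight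
    obtain ⟨n, rfl⟩ := Nat.exists_eq_add_of_le ht
    rw [eq_sum_transition c hc.step le_rfl n i]
    calc weightFloor N a B ≤ a ^ n := pow_le_pow_of_le_one ha.1.le ha.2.le (by omega)
      _ ≤ transition W 1 n i i * c 1 i := by
        rw [hc.one, mul_one]; exact pow_le_transition_diag h ha.1 le_rfl n i
      _ ≤ _ := Finset.single_le_sum (f := fun j => transition W 1 n i j * c 1 j)
        (fun j _ => mul_nonneg (transition_nonneg h le_rfl n i j) (hc.nonneg h le_rfl j))
        (Finset.mem_univ i)
  · obtain ⟨s, rfl⟩ := Nat.exists_eq_add_of_le' htL.le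
    have hs : 1 ≤ s := by omega
    have hN : (1 : ℝ) ≤ N := by exact_mod_cast i.pos
    rw [eq_sum_transition c hc.step hs _ i]
    calc weightFloor N a B ≤ weightFloor N a B * N :=
          le_mul_of_one_le_right (weightFloor_pos ha).le hN
      _ = ∑ j, weightFloor N a B * c s j := by rw [← Finset.mul_sum, hc.sum_eq h hs]
      _ ≤ _ := Finset.sum_le_sum fun j _ => mul_le_mul_of_nonneg_right
        (weightFloor_le_transition h ha.1 hB hs i j) (hc.nonneg h hs j)

theorem le_card (hc : IsPushSumWeight W c) (h : NetworkAssumption Γ W a B) {t : ℕ} (ht : 1 ≤ t)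
    (i : Fin N) : c t i ≤ N := by
  rw [← hc.sum_eq h ht]
  exact Finset.single_le_sum (fun j _ => hc.nonneg h ht j) (Finset.mem_univ i)

end IsPushSumWeight

/-! ### Consensus of perturbed push-sum ratios -/

/-- Two weighted sums with the same total weight `m` of points of mutual distance at most `D`
are at distance at most `m * D`. -/
theorem norm_weighted_sub_weighted_le {ι E : Type*} [Fintype ι] [NormedAddCommGroup E]
    [NormedSpace ℝ E] {u v : ι → ℝ} {r : ι → E} {m D : ℝ} (hu : ∀ j, 0 ≤ u j)
    (hv : ∀ j, 0 ≤ v j) (hum : ∑ j, u j = m) (hvm : ∑ j, v j = m)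
    (hr : ∀ j k, ‖r j - r k‖ ≤ D) : ‖∑ j, u j • r j - ∑ j, v j • r j‖ ≤ m * D := by
  have hm : 0 ≤ m := hum ▸ Finset.sum_nonneg fun j _ => hu j
  rcases hm.eq_or_lt with rfl | hm
  · have hu0 : ∀ j, u j = 0 := fun j =>
      (Finset.sum_eq_zero_iff_of_nonneg fun j _ => hu j).1 hum j (Finset.mem_univ j)
    have hv0 : ∀ j, v j = 0 := fun j =>
      (Finset.sum_eq_zero_iff_of_nonneg fun j _ => hv j).1 hvm j (Finset.mem_univ j)
    simp [hu0, hv0]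
  -- couple the two weights by their product measure
  have key : m • (∑ j, u j • r j - ∑ j, v j • r j) = ∑ j, ∑ k, (u j * v k) • (r j - r k) := by
    have h1 : ∑ j, ∑ k, (u j * v k) • r j = m • ∑ j, u j • r j := by
      rw [Finset.smul_sum]
      refine Finset.sum_congr rfl fun j _ => ?_
      rw [← Finset.sum_smul, ← Finset.mul_sum, hvm, smul_smul, mul_comm]
    have h2 : ∑ j, ∑ k, (u j * v k) • r k = m • ∑ j, v j • r j := by
      rw [Finset.sum_comm, Finset.smul_sum]
      refine Finset.sum_congr rfl fun j _ => ?_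
      rw [← Finset.sum_smul, ← Finset.sum_mul, hum, smul_smul]
    simp only [smul_sub, Finset.sum_sub_distrib]
    rw [h1, h2]
  have hnorm : m * ‖∑ j, u j • r j - ∑ j, v j • r j‖ ≤ m * (m * D) := by
    calc m * ‖∑ j, u j • r j - ∑ j, v j • r j‖
        = ‖∑ j, ∑ k, (u j * v k) • (r j - r k)‖ := by
          rw [← key, norm_smul, Real.norm_of_nonneg hm.le]
      _ ≤ ∑ j, ∑ k, u j * v k * D := by
          refine (norm_sum_le _ _).trans (Finset.sum_le_sum fun j _ => (norm_sum_le _ _).trans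
            (Finset.sum_le_sum fun k _ => ?_))
          rw [norm_smul, Real.norm_of_nonneg (mul_nonneg (hu j) (hv k))]
          exact mul_le_mul_of_nonneg_left (hr j k) (mul_nonneg (hu j) (hv k))
      _ = m * (m * D) := by
          simp only [← Finset.sum_mul, ← Finset.mul_sum]
          rw [hum, hvm, mul_assoc]
  exact le_of_mul_le_mul_left hnorm hm

/-- Averages that both give weight at least `δ` to the same point are closer by the factor
`1 - δ`. -/
theorem norm_average_sub_average_le {ι E : Type*} [Fintype ι] [NormedAddCommGroup E]
    [NormedSpace ℝ E] {u v : ι → ℝ} {r : ι → E} {δ D : ℝ} (hu : ∀ j, 0 ≤ u j)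
    (hv : ∀ j, 0 ≤ v j) (hu1 : ∑ j, u j = 1) (hv1 : ∑ j, v j = 1) (j₀ : ι) (huδ : δ ≤ u j₀)
    (hvδ : δ ≤ v j₀) (hr : ∀ j k, ‖r j - r k‖ ≤ D) :
    ‖∑ j, u j • r j - ∑ j, v j • r j‖ ≤ (1 - δ) * D := by
  classical
  have hsplit : ∀ w : ι → ℝ, ∑ j, w j • r j
      = ∑ j, (w j - if j = j₀ then δ else 0) • r j + δ • r j₀ := by
    intro w
    simp [sub_smul, ite_smul]
  have hnonneg : ∀ w : ι → ℝ, (∀ j, 0 ≤ w j) → δ ≤ w j₀ →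
      ∀ j, 0 ≤ w j - if j = j₀ then δ else 0 := by
    intro w hw hwδ j
    split_ifs with hj
    · subst hj; linarith
    · simpa using hw j
  rw [hsplit u, hsplit v, add_sub_add_right_eq_sub]
  refine norm_weighted_sub_weighted_le (hnonneg u hu huδ) (hnonneg v hv hvδ) ?_ ?_ hr <;>
    simp [*]

variable {E : Type*} [NormedAddCommGroup E] [NormedSpace ℝ E]

/-- Column stochastic mixing does not amplify perturbations in the `ℓ¹` sense, so that they add
up at most linearly in time. -/
theorem sum_norm_sub_transition_le (h : NetworkAssumption Γ W a B) {z : ℕ → Fin N → E} {ε : ℝ}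
    (hz : ∀ t, 1 ≤ t → ∀ i, ‖z (t + 1) i - ∑ j, W t i j • z t j‖ ≤ ε) {s : ℕ} (hs : 1 ≤ s)
    (n : ℕ) : ∑ i, ‖z (s + n) i - ∑ j, transition W s n i j • z s j‖ ≤ n * (N * ε) := by
  induction n with
  | zero => simp [transition, Matrix.one_apply]
  | succ n ih =>
    have hsn : 1 ≤ s + n := by omega
    have hstep : ∀ i, ‖z (s + (n + 1)) i - ∑ j, transition W s (n + 1) i j • z s j‖
        ≤ ε + ∑ k, W (s + n) i k • ‖z (s + n) k - ∑ j, transition W s n k j • z s j‖ := by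
      intro i
      have heq : z (s + (n + 1)) i - ∑ j, transition W s (n + 1) i j • z s j
          = (z (s + n + 1) i - ∑ k, W (s + n) i k • z (s + n) k)
            + ∑ k, W (s + n) i k • (z (s + n) k - ∑ j, transition W s n k j • z s j) := by
        have hT : ∑ j, transition W s (n + 1) i j • z s j
            = ∑ k, W (s + n) i k • ∑ j, transition W s n k j • z s j := by
          simp only [transition_succ_apply, Finset.sum_smul, Finset.smul_sum, smul_smul]
          exact Finset.sum_comm
        simp only [smul_sub, Finset.sum_sub_distrib]
        rw [hT, ← add_assoc]
        abel
      rw [heq]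
      refine (norm_add_le _ _).trans (add_le_add (hz _ hsn i) ((norm_sum_le _ _).trans
        (Finset.sum_le_sum fun k _ => ?_)))
      rw [norm_smul, Real.norm_of_nonneg ((h.mixing _ hsn).nonneg i k), smul_eq_mul]
    refine (Finset.sum_le_sum fun i _ => hstep i).trans ?_
    rw [Finset.sum_add_distrib,
      sum_sum_smul_of_columnStochastic (h.columnStochastic _ hsn)]
    simp only [Finset.sum_const, Finset.card_univ, Fintype.card_fin, nsmul_eq_mul]
    push_cast
    linarith

/-- A bound for the disagreement caused by perturbations of size `ε` within `mixTime N B`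
steps. -/
noncomputable def windowDrift (N : ℕ) (a : ℝ) (B : ℕ) (ε : ℝ) : ℝ :=
  2 * (mixTime N B * (N * ε)) / weightFloor N a B

/-- A bound, uniform in time, for the disagreement of push-sum ratios that start from values of
norm at most `ρ` and are perturbed by at most `ε` in each step. The ratio
`weightFloor N a B ^ 2 / N` is the contraction gain over `mixTime N B` steps. -/
noncomputable def disagreementBound (N : ℕ) (a : ℝ) (B : ℕ) (ε ρ : ℝ) : ℝ :=
  2 * ρ + windowDrift N a B ε + windowDrift N a B ε / (weightFloor N a B ^ 2 / N)

theorem windowDrift_nonneg (ha : a ∈ Set.Ioo (0 : ℝ) 1) {ε : ℝ} (hε : 0 ≤ ε) :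
    0 ≤ windowDrift N a B ε := by
  have := weightFloor_pos (N := N) (B := B) ha
  unfold windowDrift
  positivity

namespace IsPushSumWeight

variable {c : ℕ → Fin N → ℝ}

/-- The ratios `z / c` after `n` steps are, up to the accumulated perturbation, averages of the
ratios at the start, with weights `transition i j * c j / c i`. -/
theorem norm_ratio_sub_ratio_le (hc : IsPushSumWeight W c) (h : NetworkAssumption Γ W a B)
    (ha : a ∈ Set.Ioo (0 : ℝ) 1) (hB : 0 < B) {z : ℕ → Fin N → E} {ε : ℝ} (hε : 0 ≤ ε)
    (hz : ∀ t, 1 ≤ t → ∀ i, ‖z (t + 1) i - ∑ j, W t i j • z t j‖ ≤ ε) {s n : ℕ} (hs : 1 ≤ s)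
    (hn : n ≤ mixTime N B) {δ D : ℝ}
    (hδ : ∀ i j, δ ≤ transition W s n i j * c s j / c (s + n) i)
    (hD : ∀ j k, ‖(c s j)⁻¹ • z s j - (c s k)⁻¹ • z s k‖ ≤ D) (i k : Fin N) :
    ‖(c (s + n) i)⁻¹ • z (s + n) i - (c (s + n) k)⁻¹ • z (s + n) k‖
      ≤ (1 - δ) * D + windowDrift N a B ε := by
  have hw := weightFloor_pos (N := N) (B := B) ha
  have hsn : 1 ≤ s + n := by omega
  have hpos : ∀ {t}, 1 ≤ t → ∀ l, 0 < c t l := fun ht l =>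
    hw.trans_le (hc.weightFloor_le h ha hB ht l)
  have herr : ∀ l, ‖(c (s + n) l)⁻¹ • z (s + n) l
      - ∑ j, (transition W s n l j * c s j / c (s + n) l) • ((c s j)⁻¹ • z s j)‖
      ≤ mixTime N B * (N * ε) / weightFloor N a B := by
    intro l
    have heq : (c (s + n) l)⁻¹ • z (s + n) l
        - ∑ j, (transition W s n l j * c s j / c (s + n) l) • ((c s j)⁻¹ • z s j)
        = (c (s + n) l)⁻¹ • (z (s + n) l - ∑ j, transition W s n l j • z s j) := by
      rw [smul_sub, Finset.smul_sum]
      congr 1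
      refine Finset.sum_congr rfl fun j _ => ?_
      rw [smul_smul, smul_smul]
      congr 1
      have := (hpos hs j).ne'
      field_simp
    rw [heq, norm_smul, Real.norm_of_nonneg (inv_nonneg.2 (hpos hsn l).le), mul_comm,
      ← div_eq_mul_inv]
    refine div_le_div₀ (by positivity) ?_ hw (hc.weightFloor_le h ha hB hsn l)
    calc ‖z (s + n) l - ∑ j, transition W s n l j • z s j‖
        ≤ ∑ i, ‖z (s + n) i - ∑ j, transition W s n i j • z s j‖ :=
          Finset.single_le_sum
            (f := fun i => ‖z (s + n) i - ∑ j, transition W s n i j • z s j‖)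
            (fun _ _ => norm_nonneg _) (Finset.mem_univ l)
      _ ≤ n * (N * ε) := sum_norm_sub_transition_le h hz hs n
      _ ≤ mixTime N B * (N * ε) := by gcongr
  have hnonneg : ∀ l j, 0 ≤ transition W s n l j * c s j / c (s + n) l := fun l j =>
    div_nonneg (mul_nonneg (transition_nonneg h hs n l j) (hpos hs j).le) (hpos hsn l).le
  have hsum : ∀ l, ∑ j, transition W s n l j * c s j / c (s + n) l = 1 := fun l => by
    rw [← Finset.sum_div, ← eq_sum_transition c hc.step hs n l, div_self (hpos hsn l).ne']
  have havg := norm_average_sub_average_le (hnonneg i) (hnonneg k) (hsum i) (hsum k) i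
    (hδ i i) (hδ k i) hD
  have hi := herr i
  have hk := herr k
  rw [norm_sub_rev] at hk
  have hdrift : windowDrift N a B ε = mixTime N B * (N * ε) / weightFloor N a B
      + mixTime N B * (N * ε) / weightFloor N a B := by
    rw [windowDrift]; ring
  rw [hdrift]
  refine (norm_sub_le_norm_sub_add_norm_sub _
    (∑ j, (transition W s n i j * c s j / c (s + n) i) • ((c s j)⁻¹ • z s j)) _).trans ?_
  have := norm_sub_le_norm_sub_add_norm_sub
    (∑ j, (transition W s n i j * c s j / c (s + n) i) • ((c s j)⁻¹ • z s j))
    (∑ j, (transition W s n k j * c s j / c (s + n) k) • ((c s j)⁻¹ • z s j))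
    ((c (s + n) k)⁻¹ • z (s + n) k)
  linarith

/-- Push-sum ratios with bounded perturbations stay within bounded distance of each other: over
`mixTime N B` steps the contraction absorbs the accumulated perturbation. -/
theorem norm_ratio_sub_ratio_le_disagreementBound (hc : IsPushSumWeight W c)
    (h : NetworkAssumption Γ W a B) (ha : a ∈ Set.Ioo (0 : ℝ) 1) (hB : 0 < B)
    {z : ℕ → Fin N → E} {ε ρ : ℝ} (hε : 0 ≤ ε)
    (hz : ∀ t, 1 ≤ t → ∀ i, ‖z (t + 1) i - ∑ j, W t i j • z t j‖ ≤ ε)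
    (hρ : ∀ i, ‖z 1 i‖ ≤ ρ) {t : ℕ} (ht : 1 ≤ t) (i k : Fin N) :
    ‖(c t i)⁻¹ • z t i - (c t k)⁻¹ • z t k‖ ≤ disagreementBound N a B ε ρ := by
  have hw := weightFloor_pos (N := N) (B := B) ha
  have hdrift := windowDrift_nonneg (N := N) (B := B) ha hε
  have hN : (0 : ℝ) < N := by exact_mod_cast i.pos
  have hgain : 0 < weightFloor N a B ^ 2 / N := by positivity
  have hpos : ∀ {t}, 1 ≤ t → ∀ l, 0 < c t l := fun ht l =>
    hw.trans_le (hc.weightFloor_le h ha hB ht l)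
  induction t using Nat.strong_induction_on generalizing i k with
  | _ t ih =>
    rcases le_or_gt t (mixTime N B) with htL | htL
    · obtain ⟨n, rfl⟩ := Nat.exists_eq_add_of_le ht
      have hstart : ∀ j k, ‖(c 1 j)⁻¹ • z 1 j - (c 1 k)⁻¹ • z 1 k‖ ≤ 2 * ρ := by
        intro j k
        simp only [hc.one, inv_one, one_smul]
        have := norm_sub_le (z 1 j) (z 1 k)
        linarith [hρ j, hρ k]
      have := hc.norm_ratio_sub_ratio_le h ha hB hε hz le_rfl (n := n) (by omega) (δ := 0)
        (fun i j => div_nonneg (mul_nonneg (transition_nonneg h le_rfl n i j)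
          (hpos le_rfl j).le) (hpos (by omega) i).le) hstart i k
      have h3 := div_nonneg hdrift hgain.le
      unfold disagreementBound
      linarith
    · obtain ⟨s, rfl⟩ := Nat.exists_eq_add_of_le' htL.le
      have hs : 1 ≤ s := by omega
      have hL : 0 < mixTime N B := Nat.mul_pos N.succ_pos hB
      have := hc.norm_ratio_sub_ratio_le h ha hB hε hz hs le_rfl
        (δ := weightFloor N a B ^ 2 / N) (fun i j => by
          refine div_le_div₀ (mul_nonneg (transition_nonneg h hs _ i j) (hpos hs j).le) ?_
            (hpos ht i) (hc.le_card h ht i)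
          rw [pow_two]
          exact mul_le_mul (weightFloor_le_transition h ha.1 hB hs i j)
            (hc.weightFloor_le h ha hB hs j) hw.le (transition_nonneg h hs _ i j))
        (fun j k => ih s (by omega) hs j k) i k
      refine this.trans ?_
      have habs : windowDrift N a B ε
          ≤ weightFloor N a B ^ 2 / N * disagreementBound N a B ε ρ := by
        have hρ0 : 0 ≤ ρ := (norm_nonneg _).trans (hρ i)
        calc windowDrift N a B ε = weightFloor N a B ^ 2 / N *
              (windowDrift N a B ε / (weightFloor N a B ^ 2 / N)) :=
              (mul_div_cancel₀ _ hgain.ne').symm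
          _ ≤ _ := by
            refine mul_le_mul_of_nonneg_left ?_ hgain.le
            unfold disagreementBound
            linarith
      linarith

end IsPushSumWeight

end Network

/-! ### Projection onto the nonnegative orthant -/

section Projection

variable {p : ℕ}

theorem projNonneg_apply (v : EuclideanSpace ℝ (Fin p)) (k : Fin p) :
    projNonneg v k = max (v k) 0 := rfl

theorem norm_le_norm_of_abs_le {v w : EuclideanSpace ℝ (Fin p)} (h : ∀ k, |v k| ≤ |w k|) :
    ‖v‖ ≤ ‖w‖ := by
  rw [EuclideanSpace.norm_eq, EuclideanSpace.norm_eq]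
  exact Real.sqrt_le_sqrt (Finset.sum_le_sum fun k _ => by
    simpa only [Real.norm_eq_abs] using pow_le_pow_left₀ (abs_nonneg _) (h k) 2)

theorem norm_projNonneg_le (v : EuclideanSpace ℝ (Fin p)) : ‖projNonneg v‖ ≤ ‖v‖ :=
  norm_le_norm_of_abs_le fun k => by
    rw [projNonneg_apply, abs_of_nonneg (le_max_right _ _)]
    exact max_le (le_abs_self _) (abs_nonneg _)

theorem norm_projNonneg_add_sub_le {m : EuclideanSpace ℝ (Fin p)} (hm : ∀ k, 0 ≤ m k)
    (v : EuclideanSpace ℝ (Fin p)) : ‖projNonneg (m + v) - m‖ ≤ ‖v‖ :=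
  norm_le_norm_of_abs_le fun k => by
    simp only [PiLp.sub_apply, projNonneg_apply, PiLp.add_apply]
    have h := abs_max_sub_max_le_abs (m k + v k) (m k) 0
    rwa [max_eq_left (hm k), add_sub_cancel_left] at h

theorem inner_eq_sum_mul (v w : EuclideanSpace ℝ (Fin p)) : inner ℝ v w = ∑ k, v k * w k := by
  rw [PiLp.inner_apply]
  exact Finset.sum_congr rfl fun k _ => by simp [mul_comm]

end Projection

/-! ### The proximal step -/

/-- A minimiser of a convex function plus `η * ‖· - b‖ ^ 2` satisfies the minimality inequality
with the extra quadratic term that strong convexity provides. -/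
theorem add_sq_le_of_isMinOn {E : Type*} [NormedAddCommGroup E] [InnerProductSpace ℝ E]
    {S : Set E} {φ : E → ℝ} (hφ : ConvexOn ℝ S φ) {η : ℝ} {b u v : E} (hu : u ∈ S) (hv : v ∈ S)
    (hmin : IsMinOn (fun z => φ z + η * ‖z - b‖ ^ 2) S u) :
    φ u + η * ‖u - b‖ ^ 2 + η * ‖v - u‖ ^ 2 ≤ φ v + η * ‖v - b‖ ^ 2 := by
  have hseg : ∀ θ ∈ Set.Ioo (0 : ℝ) 1, φ u + η * ‖u - b‖ ^ 2 + (1 - θ) * (η * ‖v - u‖ ^ 2)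
      ≤ φ v + η * ‖v - b‖ ^ 2 := by
    rintro θ ⟨h0, h1⟩
    have hmem : (1 - θ) • u + θ • v ∈ S := hφ.1 hu hv (by linarith) h0.le (by ring)
    have hconv := hφ.2 hu hv (by linarith : 0 ≤ 1 - θ) h0.le (by ring)
    have hle := isMinOn_iff.1 hmin _ hmem
    have hsq : ‖(1 - θ) • u + θ • v - b‖ ^ 2
        = (1 - θ) * ‖u - b‖ ^ 2 + θ * ‖v - b‖ ^ 2 - θ * (1 - θ) * ‖v - u‖ ^ 2 := by
      have e1 : (1 - θ) • u + θ • v - b = (u - b) + θ • (v - u) := by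
        rw [smul_sub, sub_smul, one_smul]; abel
      have e2 : v - b = (u - b) + (v - u) := by abel
      rw [e1, e2, norm_add_sq_real, norm_add_sq_real, norm_smul, inner_smul_right, mul_pow,
        Real.norm_eq_abs, sq_abs]
      ring
    simp only [smul_eq_mul] at hconv hle
    rw [hsq] at hle
    refine le_of_mul_le_mul_left ?_ h0
    linarith
  have hlim : Filter.Tendsto
      (fun θ : ℝ => φ u + η * ‖u - b‖ ^ 2 + (1 - θ) * (η * ‖v - u‖ ^ 2))
      (nhdsWithin 0 (Set.Ioi 0)) (nhds (φ u + η * ‖u - b‖ ^ 2 + (1 - 0) * (η * ‖v - u‖ ^ 2))) :=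
    ((by fun_prop : Continuous fun θ : ℝ =>
      φ u + η * ‖u - b‖ ^ 2 + (1 - θ) * (η * ‖v - u‖ ^ 2)).tendsto 0).mono_left
        nhdsWithin_le_nhds
  rw [sub_zero, one_mul] at hlim
  exact le_of_tendsto hlim
    (Filter.eventually_of_mem (Ioo_mem_nhdsGT one_pos) hseg)

/-! ### Dual iterates -/

/-- A bound for the trackers `y`, which follow the average constraint value (at most `F`) up to
the disagreement caused by increments of norm at most `2 * F`. -/
noncomputable def trackerBound (N : ℕ) (a : ℝ) (B : ℕ) (F : ℝ) : ℝ :=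
  N * (F + disagreementBound N a B (2 * F) F)

/-- A bound for the disagreement of the local multipliers `lam`. -/
noncomputable def multiplierBound (N : ℕ) (a : ℝ) (B : ℕ) (F : ℝ) : ℝ :=
  disagreementBound N a B (trackerBound N a B F) 0
    + 2 * (trackerBound N a B F / weightFloor N a B)

/-- The total error made in one step of the drift analysis: the linearised cost, the two
consensus errors, and the quadratic term of the dual drift. -/
noncomputable def stepError (N : ℕ) (a : ℝ) (B : ℕ) (F G : ℝ) : ℝ :=
  N * (G ^ 2 / 4) + N * (multiplierBound N a B F * (trackerBound N a B F + F))
    + N * (multiplierBound N a B F * F)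
    + N * (trackerBound N a B F ^ 2 / weightFloor N a B) / 2

section Bounds

variable {N : ℕ} {a : ℝ} {B : ℕ} {F G : ℝ}

theorem disagreementBound_nonneg (ha : a ∈ Set.Ioo (0 : ℝ) 1) {ε ρ : ℝ} (hε : 0 ≤ ε)
    (hρ : 0 ≤ ρ) : 0 ≤ disagreementBound N a B ε ρ := by
  have := windowDrift_nonneg (N := N) (B := B) ha hε
  unfold disagreementBound
  positivity

theorem trackerBound_nonneg (ha : a ∈ Set.Ioo (0 : ℝ) 1) (hF : 0 ≤ F) :
    0 ≤ trackerBound N a B F := by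
  have := disagreementBound_nonneg (N := N) (B := B) ha (mul_nonneg zero_le_two hF) hF
  unfold trackerBound
  positivity

theorem multiplierBound_nonneg (ha : a ∈ Set.Ioo (0 : ℝ) 1) (hF : 0 ≤ F) :
    0 ≤ multiplierBound N a B F := by
  have h1 := trackerBound_nonneg (N := N) (B := B) ha hF
  have h2 := disagreementBound_nonneg (N := N) (B := B) ha h1 le_rfl
  have h3 := weightFloor_pos (N := N) (B := B) ha
  unfold multiplierBound
  positivity

theorem stepError_nonneg (ha : a ∈ Set.Ioo (0 : ℝ) 1) (hF : 0 ≤ F) :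
    0 ≤ stepError N a B F G := by
  have h1 := trackerBound_nonneg (N := N) (B := B) ha hF
  have h2 := multiplierBound_nonneg (N := N) (B := B) ha hF
  have h3 := weightFloor_pos (N := N) (B := B) ha
  unfold stepError
  positivity

end Bounds

namespace IsRun

variable {N p : ℕ} {a : ℝ} {B : ℕ} {F G R : ℝ} {Γ : ℕ → Digraph (Fin N)}
  {W : ℕ → Matrix (Fin N) (Fin N) ℝ} {P : Problem N p}
  {df : ℕ → (i : Fin N) → EuclideanSpace ℝ (Fin (P.d i)) → EuclideanSpace ℝ (Fin (P.d i))}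
  {α η : ℕ → ℝ} {c : ℕ → Fin N → ℝ} {lam : ℕ → Fin N → EuclideanSpace ℝ (Fin p)}
  {x : ℕ → P.Decision} {y μ : ℕ → Fin N → EuclideanSpace ℝ (Fin p)}

theorem isPushSumWeight (run : IsRun P Γ W df α η c lam x y μ) (h : NetworkAssumption Γ W a B) :
    IsPushSumWeight W c where
  one := run.init_c
  step t ht i := by
    rw [run.step_c t ht i]
    exact (h.mixing t ht).sum_inNeighbors i (c t)

theorem weight_pos (run : IsRun P Γ W df α η c lam x y μ) (h : NetworkAssumption Γ W a B)
    (ha : a ∈ Set.Ioo (0 : ℝ) 1) (hB : 0 < B) {t : ℕ} (ht : 1 ≤ t) (i : Fin N) : 0 < c t i :=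
  (weightFloor_pos ha).trans_le ((run.isPushSumWeight h).weightFloor_le h ha hB ht i)

theorem x_mem (run : IsRun P Γ W df α η c lam x y μ) {t : ℕ} (ht : 1 ≤ t) (i : Fin N) :
    x t i ∈ P.X i := by
  obtain rfl | ht' := ht.eq_or_lt
  · exact run.init_x i
  · obtain ⟨s, rfl⟩ := Nat.exists_eq_add_of_le' ht
    exact run.step_x_mem s (by omega) i

theorem lam_succ (run : IsRun P Γ W df α η c lam x y μ) (h : NetworkAssumption Γ W a B) {t : ℕ}
    (ht : 1 ≤ t) (i : Fin N) :
    lam (t + 1) i = (c (t + 1) i)⁻¹ • ∑ j, W t i j • μ t j := by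
  rw [run.step_lam t ht i, (h.mixing t ht).sum_inNeighbors]

theorem y_succ (run : IsRun P Γ W df α η c lam x y μ) (h : NetworkAssumption Γ W a B) {t : ℕ}
    (ht : 1 ≤ t) (i : Fin N) :
    y (t + 1) i = ∑ j, W t i j • y t j + P.g i (x (t + 1) i) - P.g i (x t i) := by
  rw [run.step_y t ht i, (h.mixing t ht).sum_inNeighbors]

theorem μ_succ (run : IsRun P Γ W df α η c lam x y μ) (h : NetworkAssumption Γ W a B) {t : ℕ}
    (ht : 1 ≤ t) (i : Fin N) :
    μ (t + 1) i = projNonneg (∑ j, W t i j • μ t j + y (t + 1) i) := by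
  rw [run.step_μ t ht i, (h.mixing t ht).sum_inNeighbors]

theorem μ_nonneg (run : IsRun P Γ W df α η c lam x y μ) {t : ℕ} (ht : 1 ≤ t) (i : Fin N)
    (k : Fin p) : 0 ≤ μ t i k := by
  obtain rfl | ht' := ht.eq_or_lt
  · simp [run.init_μ]
  · obtain ⟨s, rfl⟩ := Nat.exists_eq_add_of_le' ht
    rw [run.step_μ s (by omega) i, projNonneg_apply]
    exact le_max_right _ _

theorem mixed_μ_nonneg (run : IsRun P Γ W df α η c lam x y μ) (h : NetworkAssumption Γ W a B)
    {t : ℕ} (ht : 1 ≤ t) (i : Fin N) (k : Fin p) : 0 ≤ (∑ j, W t i j • μ t j) k := by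
  rw [WithLp.ofLp_sum, Finset.sum_apply]
  exact Finset.sum_nonneg fun j _ => mul_nonneg ((h.mixing t ht).nonneg i j) (run.μ_nonneg ht j k)

theorem lam_nonneg (run : IsRun P Γ W df α η c lam x y μ) (h : NetworkAssumption Γ W a B)
    (ha : a ∈ Set.Ioo (0 : ℝ) 1) (hB : 0 < B) {t : ℕ} (ht : 1 ≤ t) (i : Fin N) (k : Fin p) :
    0 ≤ lam (t + 1) i k := by
  rw [run.lam_succ h ht i]
  exact mul_nonneg (inv_nonneg.2 (run.weight_pos h ha hB (by omega) i).le)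
    (run.mixed_μ_nonneg h ht i k)

/-- The trackers preserve the total constraint value, because mixing is column stochastic. -/
theorem sum_y (run : IsRun P Γ W df α η c lam x y μ) (h : NetworkAssumption Γ W a B) {t : ℕ}
    (ht : 1 ≤ t) : ∑ i, y t i = ∑ i, P.g i (x t i) := by
  induction t, ht using Nat.le_induction with
  | base => simp [run.init_y]
  | succ t ht ih =>
    simp only [run.y_succ h ht, Finset.sum_sub_distrib, Finset.sum_add_distrib]
    rw [sum_sum_smul_of_columnStochastic (h.columnStochastic t ht), ih]
    abel

theorem norm_y_le (run : IsRun P Γ W df α η c lam x y μ) (h : NetworkAssumption Γ W a B)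
    (ha : a ∈ Set.Ioo (0 : ℝ) 1) (hB : 0 < B) (hF : 0 ≤ F)
    (hg : ∀ i, ∀ z ∈ P.X i, ‖P.g i z‖ ≤ F) {t : ℕ} (ht : 1 ≤ t) (i : Fin N) :
    ‖y t i‖ ≤ trackerBound N a B F := by
  have hc := run.isPushSumWeight h
  have hN : (0 : ℝ) < N := by exact_mod_cast i.pos
  have hpert : ∀ t, 1 ≤ t → ∀ i, ‖y (t + 1) i - ∑ j, W t i j • y t j‖ ≤ 2 * F := by
    intro t ht i
    rw [run.y_succ h ht i, add_sub_assoc, add_sub_cancel_left]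
    have h1 := hg i _ (run.x_mem ht i)
    have h2 := hg i _ (run.x_mem (Nat.le_succ_of_le ht) i)
    linarith [norm_sub_le (P.g i (x (t + 1) i)) (P.g i (x t i))]
  have hdis := fun j => hc.norm_ratio_sub_ratio_le_disagreementBound h ha hB (by positivity) hpert
    (fun i => (run.init_y i ▸ hg i _ (run.init_x i) : ‖y 1 i‖ ≤ F)) ht i j
  have hpos := fun j => run.weight_pos h ha hB ht j
  -- the average of the ratios `y / c` with weights `c` is the average constraint value
  have havg : (N : ℝ) • ((c t i)⁻¹ • y t i)
      = ∑ j, P.g j (x t j) + ∑ j, c t j • ((c t i)⁻¹ • y t i - (c t j)⁻¹ • y t j) := by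
    have h1 : ∑ j, c t j • (c t j)⁻¹ • y t j = ∑ j, P.g j (x t j) := by
      rw [← run.sum_y h ht]
      exact Finset.sum_congr rfl fun j _ => smul_inv_smul₀ (hpos j).ne' _
    simp only [smul_sub (c t _), Finset.sum_sub_distrib]
    rw [h1, ← Finset.sum_smul, hc.sum_eq h ht]
    abel
  have hratio : ‖(c t i)⁻¹ • y t i‖ ≤ F + disagreementBound N a B (2 * F) F := by
    refine le_of_mul_le_mul_left ?_ hN
    calc (N : ℝ) * ‖(c t i)⁻¹ • y t i‖ = ‖(N : ℝ) • ((c t i)⁻¹ • y t i)‖ := by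
          rw [norm_smul (N : ℝ), Real.norm_natCast]
      _ ≤ ∑ j : Fin N, F + ∑ j, c t j * disagreementBound N a B (2 * F) F := by
          rw [havg]
          refine (norm_add_le _ _).trans (add_le_add
            ((norm_sum_le _ _).trans (Finset.sum_le_sum fun j _ => hg j _ (run.x_mem ht j)))
            ((norm_sum_le _ _).trans (Finset.sum_le_sum fun j _ => ?_)))
          rw [norm_smul, Real.norm_of_nonneg (hpos j).le]
          exact mul_le_mul_of_nonneg_left (hdis j) (hpos j).le
      _ = N * (F + disagreementBound N a B (2 * F) F) := by
          rw [← Finset.sum_mul, hc.sum_eq h ht]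
          simp [mul_add]
  calc ‖y t i‖ = c t i * ‖(c t i)⁻¹ • y t i‖ := by
        rw [norm_smul, Real.norm_of_nonneg (inv_nonneg.2 (hpos i).le),
          mul_inv_cancel_left₀ (hpos i).ne']
    _ ≤ trackerBound N a B F := mul_le_mul (hc.le_card h ht i) hratio (norm_nonneg _) hN.le

/-- Since the mixed multipliers are nonnegative, projecting after adding `y` moves them by at
most `‖y‖`. -/
theorem norm_μ_sub_le (run : IsRun P Γ W df α η c lam x y μ) (h : NetworkAssumption Γ W a B)
    (ha : a ∈ Set.Ioo (0 : ℝ) 1) (hB : 0 < B) (hF : 0 ≤ F)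
    (hg : ∀ i, ∀ z ∈ P.X i, ‖P.g i z‖ ≤ F) {t : ℕ} (ht : 1 ≤ t) (i : Fin N) :
    ‖μ (t + 1) i - ∑ j, W t i j • μ t j‖ ≤ trackerBound N a B F := by
  rw [run.μ_succ h ht i]
  exact (norm_projNonneg_add_sub_le (run.mixed_μ_nonneg h ht i) _).trans
    (run.norm_y_le h ha hB hF hg (Nat.le_succ_of_le ht) i)

theorem norm_lam_sub_lam_le (run : IsRun P Γ W df α η c lam x y μ)
    (h : NetworkAssumption Γ W a B) (ha : a ∈ Set.Ioo (0 : ℝ) 1) (hB : 0 < B) (hF : 0 ≤ F)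
    (hg : ∀ i, ∀ z ∈ P.X i, ‖P.g i z‖ ≤ F) {t : ℕ} (ht : 1 ≤ t) (i k : Fin N) :
    ‖lam (t + 1) i - lam (t + 1) k‖ ≤ multiplierBound N a B F := by
  have ht' : 1 ≤ t + 1 := by omega
  have hc := run.isPushSumWeight h
  have hY := trackerBound_nonneg (N := N) (B := B) ha hF
  have hdis := hc.norm_ratio_sub_ratio_le_disagreementBound h ha hB hY
    (fun t ht i => run.norm_μ_sub_le h ha hB hF hg ht i)
    (fun i => (by simp [run.init_μ] : ‖μ 1 i‖ ≤ 0)) ht' i k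
  have hlam : ∀ l, ‖(c (t + 1) l)⁻¹ • μ (t + 1) l - lam (t + 1) l‖
      ≤ trackerBound N a B F / weightFloor N a B := by
    intro l
    rw [run.lam_succ h ht l, ← smul_sub, norm_smul,
      Real.norm_of_nonneg (inv_nonneg.2 (run.weight_pos h ha hB ht' l).le), mul_comm,
      ← div_eq_mul_inv]
    exact div_le_div₀ hY (run.norm_μ_sub_le h ha hB hF hg ht l) (weightFloor_pos ha)
      (hc.weightFloor_le h ha hB ht' l)
  have hi := hlam i
  rw [norm_sub_rev] at hi
  have h1 := norm_sub_le_norm_sub_add_norm_sub (lam (t + 1) i) ((c (t + 1) i)⁻¹ • μ (t + 1) i)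
    (lam (t + 1) k)
  have h2 := norm_sub_le_norm_sub_add_norm_sub ((c (t + 1) i)⁻¹ • μ (t + 1) i)
    ((c (t + 1) k)⁻¹ • μ (t + 1) k) (lam (t + 1) k)
  unfold multiplierBound
  linarith [hlam k]

/-! ### Drift of the dual potential -/

/-- Weighting `‖μ i‖ ^ 2` by `1 / c i` makes the potential nonincreasing under the mixing step,
by the Cauchy–Schwarz inequality. -/
theorem sum_mul_norm_lam_sq_le (run : IsRun P Γ W df α η c lam x y μ)
    (h : NetworkAssumption Γ W a B) (ha : a ∈ Set.Ioo (0 : ℝ) 1) (hB : 0 < B) {t : ℕ}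
    (ht : 1 ≤ t) :
    ∑ i, c (t + 1) i * ‖lam (t + 1) i‖ ^ 2 ≤ ∑ j, ‖μ t j‖ ^ 2 / c t j := by
  have hpos := fun j => run.weight_pos h ha hB ht j
  rw [← sum_sum_smul_of_columnStochastic (h.columnStochastic t ht)
    fun j => ‖μ t j‖ ^ 2 / c t j]
  refine Finset.sum_le_sum fun i _ => ?_
  have hci := run.weight_pos h ha hB (Nat.le_succ_of_le ht) i
  have hW := fun j => (h.mixing t ht).nonneg i j
  have hcs : (∑ j, W t i j * ‖μ t j‖) ^ 2
      ≤ (∑ j, W t i j • (‖μ t j‖ ^ 2 / c t j)) * ∑ j, W t i j * c t j := by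
    refine Finset.sum_sq_le_sum_mul_sum_of_sq_le_mul _ (fun j _ => ?_) (fun j _ => ?_)
      fun j _ => ?_
    · exact mul_nonneg (hW j) (div_nonneg (sq_nonneg _) (hpos j).le)
    · exact mul_nonneg (hW j) (hpos j).le
    · have := (hpos j).ne'
      rw [smul_eq_mul]
      refine le_of_eq ?_
      field_simp
  rw [← (run.isPushSumWeight h).step t ht i] at hcs
  have hnorm : ‖∑ j, W t i j • μ t j‖ ≤ ∑ j, W t i j * ‖μ t j‖ :=
    (norm_sum_le _ _).trans (Finset.sum_le_sum fun j _ => by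
      rw [norm_smul, Real.norm_of_nonneg (hW j)])
  have hsq := (pow_le_pow_left₀ (norm_nonneg _) hnorm 2).trans hcs
  rw [run.lam_succ h ht i, norm_smul, Real.norm_of_nonneg (inv_nonneg.2 hci.le), mul_pow]
  calc c (t + 1) i * ((c (t + 1) i)⁻¹ ^ 2 * ‖∑ j, W t i j • μ t j‖ ^ 2)
      = ‖∑ j, W t i j • μ t j‖ ^ 2 / c (t + 1) i := by
        have := hci.ne'
        field_simp
    _ ≤ _ := (div_le_iff₀ hci).2 hsq

theorem potential_succ_le (run : IsRun P Γ W df α η c lam x y μ)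
    (h : NetworkAssumption Γ W a B) (ha : a ∈ Set.Ioo (0 : ℝ) 1) (hB : 0 < B) (hF : 0 ≤ F)
    (hg : ∀ i, ∀ z ∈ P.X i, ‖P.g i z‖ ≤ F) {t : ℕ} (ht : 1 ≤ t) :
    ∑ i, ‖μ (t + 1) i‖ ^ 2 / c (t + 1) i ≤ ∑ i, ‖μ t i‖ ^ 2 / c t i
      + 2 * ∑ i, inner ℝ (lam (t + 1) i) (y (t + 1) i)
      + N * (trackerBound N a B F ^ 2 / weightFloor N a B) := by
  have ht' : 1 ≤ t + 1 := by omega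
  have hlocal : ∀ i, ‖μ (t + 1) i‖ ^ 2 / c (t + 1) i ≤ c (t + 1) i * ‖lam (t + 1) i‖ ^ 2
      + 2 * inner ℝ (lam (t + 1) i) (y (t + 1) i)
      + trackerBound N a B F ^ 2 / weightFloor N a B := by
    intro i
    have hci := run.weight_pos h ha hB ht' i
    have hmix : ∑ j, W t i j • μ t j = c (t + 1) i • lam (t + 1) i := by
      rw [run.lam_succ h ht i, smul_inv_smul₀ hci.ne']
    have hsq : ‖μ (t + 1) i‖ ^ 2 ≤ ‖c (t + 1) i • lam (t + 1) i + y (t + 1) i‖ ^ 2 := by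
      rw [run.μ_succ h ht i, hmix]
      exact pow_le_pow_left₀ (norm_nonneg _) (norm_projNonneg_le _) 2
    rw [norm_add_sq_real, norm_smul, real_inner_smul_left, Real.norm_of_nonneg hci.le] at hsq
    have hy : ‖y (t + 1) i‖ ^ 2 / c (t + 1) i
        ≤ trackerBound N a B F ^ 2 / weightFloor N a B :=
      div_le_div₀ (sq_nonneg _)
        (pow_le_pow_left₀ (norm_nonneg _) (run.norm_y_le h ha hB hF hg ht' i) 2)
        (weightFloor_pos ha) ((run.isPushSumWeight h).weightFloor_le h ha hB ht' i)
    calc ‖μ (t + 1) i‖ ^ 2 / c (t + 1) i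
        ≤ ((c (t + 1) i * ‖lam (t + 1) i‖) ^ 2
          + 2 * (c (t + 1) i * inner ℝ (lam (t + 1) i) (y (t + 1) i))
          + ‖y (t + 1) i‖ ^ 2) / c (t + 1) i := div_le_div_of_nonneg_right hsq hci.le
      _ = c (t + 1) i * ‖lam (t + 1) i‖ ^ 2 + 2 * inner ℝ (lam (t + 1) i) (y (t + 1) i)
          + ‖y (t + 1) i‖ ^ 2 / c (t + 1) i := by
        have := hci.ne'
        field_simp
      _ ≤ _ := by linarith
  have hsum := Finset.sum_le_sum fun i (_ : i ∈ Finset.univ) => hlocal i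
  simp only [Finset.sum_add_distrib, ← Finset.mul_sum, Finset.sum_const, Finset.card_univ,
    Fintype.card_fin, nsmul_eq_mul] at hsum
  linarith [run.sum_mul_norm_lam_sq_le h ha hB ht]

/-- The trackers may be replaced by the local constraint values: both have the same sum, so only
the disagreement of the multipliers matters. -/
theorem sum_inner_lam_y_le (run : IsRun P Γ W df α η c lam x y μ)
    (h : NetworkAssumption Γ W a B) (ha : a ∈ Set.Ioo (0 : ℝ) 1) (hB : 0 < B) (hF : 0 ≤ F)
    (hg : ∀ i, ∀ z ∈ P.X i, ‖P.g i z‖ ≤ F) {t : ℕ} (ht : 1 ≤ t) :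
    ∑ i, inner ℝ (lam (t + 1) i) (y (t + 1) i)
      ≤ ∑ i, inner ℝ (lam (t + 1) i) (P.g i (x (t + 1) i))
        + N * (multiplierBound N a B F * (trackerBound N a B F + F)) := by
  have ht' : 1 ≤ t + 1 := by omega
  obtain rfl | hN := N.eq_zero_or_pos
  · simp
  let i₀ : Fin N := ⟨0, hN⟩
  have hzero : ∑ i, inner ℝ (lam (t + 1) i₀) (y (t + 1) i - P.g i (x (t + 1) i)) = 0 := by
    rw [← inner_sum, Finset.sum_sub_distrib, run.sum_y h ht', sub_self, inner_zero_right]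
  have hdiff : ∑ i, inner ℝ (lam (t + 1) i) (y (t + 1) i)
      - ∑ i, inner ℝ (lam (t + 1) i) (P.g i (x (t + 1) i))
      = ∑ i, inner ℝ (lam (t + 1) i - lam (t + 1) i₀) (y (t + 1) i - P.g i (x (t + 1) i)) := by
    simp only [inner_sub_left (𝕜 := ℝ) (lam (t + 1) _), Finset.sum_sub_distrib]
    rw [hzero, sub_zero, ← Finset.sum_sub_distrib]
    exact Finset.sum_congr rfl fun i _ => (inner_sub_right _ _ _).symm
  have hle : ∑ i, inner ℝ (lam (t + 1) i - lam (t + 1) i₀)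
      (y (t + 1) i - P.g i (x (t + 1) i))
      ≤ ∑ _i : Fin N, multiplierBound N a B F * (trackerBound N a B F + F) :=
    Finset.sum_le_sum fun i _ => (real_inner_le_norm _ _).trans
      (mul_le_mul (run.norm_lam_sub_lam_le h ha hB hF hg ht i i₀)
        ((norm_sub_le _ _).trans (add_le_add (run.norm_y_le h ha hB hF hg ht' i)
          (hg i _ (run.x_mem ht' i)))) (norm_nonneg _) (multiplierBound_nonneg ha hF))
  simp only [Finset.sum_const, Finset.card_univ, Fintype.card_fin, nsmul_eq_mul] at hle
  linarith

/-- At feasible decisions a common nonnegative multiplier would give a nonpositive value. -/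
theorem sum_inner_lam_feasible_le (run : IsRun P Γ W df α η c lam x y μ)
    (h : NetworkAssumption Γ W a B) (ha : a ∈ Set.Ioo (0 : ℝ) 1) (hB : 0 < B) (hF : 0 ≤ F)
    (hg : ∀ i, ∀ z ∈ P.X i, ‖P.g i z‖ ≤ F) {t : ℕ} (ht : 1 ≤ t) {u : P.Decision}
    (hu : u ∈ P.feasible) :
    ∑ i, inner ℝ (lam (t + 1) i) (P.g i (u i)) ≤ N * (multiplierBound N a B F * F) := by
  obtain rfl | hN := N.eq_zero_or_pos
  · simp
  let i₀ : Fin N := ⟨0, hN⟩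
  have hcommon : ∑ i, inner ℝ (lam (t + 1) i₀) (P.g i (u i)) ≤ 0 := by
    rw [← inner_sum, inner_eq_sum_mul]
    refine Finset.sum_nonpos fun k _ =>
      mul_nonpos_of_nonneg_of_nonpos (run.lam_nonneg h ha hB ht i₀ k) ?_
    rw [WithLp.ofLp_sum, Finset.sum_apply]
    exact hu.2 k
  have hle : ∑ i, inner ℝ (lam (t + 1) i - lam (t + 1) i₀) (P.g i (u i))
      ≤ ∑ _i : Fin N, multiplierBound N a B F * F :=
    Finset.sum_le_sum fun i _ => (real_inner_le_norm _ _).trans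
      (mul_le_mul (run.norm_lam_sub_lam_le h ha hB hF hg ht i i₀) (hg i _ (hu.1 i))
        (norm_nonneg _) (multiplierBound_nonneg ha hF))
  simp only [inner_sub_left, Finset.sum_sub_distrib, Finset.sum_const, Finset.card_univ,
    Fintype.card_fin, nsmul_eq_mul] at hle
  linarith

/-! ### One step of the regret analysis -/

/-- The proximal step compared with any `u` in the constraint set: strong convexity of the local
subproblem turns its minimality into a telescoping difference of squared distances. -/
theorem primal_step_le (run : IsRun P Γ W df (fun t => √t) (fun t => (t : ℝ)) c lam x y μ)
    (h : NetworkAssumption Γ W a B) (ha : a ∈ Set.Ioo (0 : ℝ) 1) (hB : 0 < B)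
    (hP : ProblemAssumption P) (hb : ProblemBounds P df F G R) {t : ℕ} (ht : 1 ≤ t) (i : Fin N)
    {u : EuclideanSpace ℝ (Fin (P.d i))} (hu : u ∈ P.X i) :
    √t * (P.f t i (x t i) - P.f t i u) + inner ℝ (lam (t + 1) i) (P.g i (x (t + 1) i))
      ≤ inner ℝ (lam (t + 1) i) (P.g i u) + G ^ 2 / 4
        + t * (‖u - x t i‖ ^ 2 - ‖u - x (t + 1) i‖ ^ 2) := by
  have hconv : ConvexOn ℝ (P.X i) fun z => √t * inner ℝ (df t i (x t i)) (z - x t i)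
      + inner ℝ (lam (t + 1) i) (P.g i z) := by
    refine ConvexOn.add ⟨hP.convex i, fun v _ w _ r s _ _ hrs => le_of_eq ?_⟩ ?_
    · have : r • v + s • w - x t i = r • (v - x t i) + s • (w - x t i) := by
        have hx : x t i = r • x t i + s • x t i := by rw [← add_smul, hrs, one_smul]
        nth_rewrite 1 [hx]
        rw [smul_sub, smul_sub]
        abel
      simp only [this, inner_add_right, inner_smul_right, smul_eq_mul]
      ring
    · refine ⟨hP.convex i, fun v hv w hw r s hr hs hrs => ?_⟩
      simp only [inner_eq_sum_mul, smul_eq_mul, Finset.mul_sum]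
      rw [← Finset.sum_add_distrib]
      refine Finset.sum_le_sum fun k _ => ?_
      have := mul_le_mul_of_nonneg_left ((hP.convex_g i k).2 hv hw hr hs hrs)
        (run.lam_nonneg h ha hB ht i k)
      simp only [smul_eq_mul] at this
      linarith
  have hmin := add_sq_le_of_isMinOn hconv (run.step_x_mem t ht i) hu (run.step_x_min t ht i)
  have hsub := mul_le_mul_of_nonneg_left (hb.subgradient t ht i _ (run.x_mem ht i) u hu)
    (Real.sqrt_nonneg t)
  -- complete the square, possible because `(√t) ^ 2 = t`: the weight of the
  -- quadratic term is the square of the weight of the linear one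
  have hsq : -(G ^ 2 / 4) ≤ √t * inner ℝ (df t i (x t i)) (x (t + 1) i - x t i)
      + t * ‖x (t + 1) i - x t i‖ ^ 2 := by
    have h1 := abs_le.1 (abs_real_inner_le_norm (df t i (x t i)) (x (t + 1) i - x t i))
    have h2 := mul_le_mul_of_nonneg_right (hb.norm_df_le t ht i _ (run.x_mem ht i))
      (norm_nonneg (x (t + 1) i - x t i))
    have h3 := mul_le_mul_of_nonneg_left (by linarith [h1.1] :
      -(G * ‖x (t + 1) i - x t i‖) ≤ inner ℝ (df t i (x t i)) (x (t + 1) i - x t i))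
      (Real.sqrt_nonneg t)
    have h4 : √(t : ℝ) ^ 2 = t := Real.sq_sqrt (Nat.cast_nonneg t)
    have h5 := sq_nonneg (√t * ‖x (t + 1) i - x t i‖ - G / 2)
    have h6 : (√t * ‖x (t + 1) i - x t i‖ - G / 2) ^ 2
        = √(t : ℝ) ^ 2 * ‖x (t + 1) i - x t i‖ ^ 2
          - √t * (G * ‖x (t + 1) i - x t i‖) + G ^ 2 / 4 := by ring
    rw [h6, h4] at h5
    linarith
  linarith

/-- The drift-plus-penalty inequality: the weighted regret in one step is paid for by the decrease
of the dual potential, the decrease of the squared distance to `u`, and a constant. -/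
theorem sqrt_mul_regret_le (run : IsRun P Γ W df (fun t => √t) (fun t => (t : ℝ)) c lam x y μ)
    (h : NetworkAssumption Γ W a B) (ha : a ∈ Set.Ioo (0 : ℝ) 1) (hB : 0 < B)
    (hP : ProblemAssumption P) (hb : ProblemBounds P df F G R) (hF : 0 ≤ F) {t : ℕ}
    (ht : 1 ≤ t) {u : P.Decision} (hu : u ∈ P.feasible) :
    √t * (∑ i, P.f t i (x t i) - ∑ i, P.f t i (u i))
      ≤ (∑ i, ‖μ t i‖ ^ 2 / c t i - ∑ i, ‖μ (t + 1) i‖ ^ 2 / c (t + 1) i) / 2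
        + stepError N a B F G
        + t * (∑ i, ‖u i - x t i‖ ^ 2 - ∑ i, ‖u i - x (t + 1) i‖ ^ 2) := by
  have hprimal := Finset.sum_le_sum fun i (_ : i ∈ Finset.univ) =>
    run.primal_step_le h ha hB hP hb ht i (hu.1 i)
  simp only [Finset.sum_add_distrib, Finset.sum_sub_distrib, ← Finset.mul_sum, Finset.sum_const,
    Finset.card_univ, Fintype.card_fin, nsmul_eq_mul] at hprimal
  have h1 := run.potential_succ_le h ha hB hF hb.norm_g_le ht
  have h2 := run.sum_inner_lam_y_le h ha hB hF hb.norm_g_le ht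
  have h3 := run.sum_inner_lam_feasible_le h ha hB hF hb.norm_g_le ht hu
  unfold stepError
  linarith

end IsRun

/-! ### Summation over time -/


/-- Abel summation against the decreasing weights `1 / √t`. -/
theorem sum_sub_div_sqrt_le {Φ : ℕ → ℝ} (hΦ : ∀ t, 1 ≤ t → 0 ≤ Φ t) {T : ℕ} (hT : 1 ≤ T) :
    ∑ t ∈ Finset.Icc 1 T, (Φ t - Φ (t + 1)) / √t ≤ Φ 1 - Φ (T + 1) / √T := by
  induction T, hT using Nat.le_induction with
  | base => simp
  | succ T hT ih =>
    rw [Finset.sum_Icc_succ_top (by omega), sub_div]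
    have : Φ (T + 1) / √(T + 1 : ℕ) ≤ Φ (T + 1) / √T :=
      div_le_div_of_nonneg_left (hΦ _ (by omega)) (Real.sqrt_pos.2 (by exact_mod_cast hT))
        (Real.sqrt_le_sqrt (by exact_mod_cast T.le_succ))
    linarith

/-- Abel summation against the increasing weights `√t`. -/
theorem sum_sqrt_mul_sub_le {Δ : ℕ → ℝ} {M : ℝ} (hΔ : ∀ t, 1 ≤ t → Δ t ≤ M) {T : ℕ}
    (hT : 1 ≤ T) :
    ∑ t ∈ Finset.Icc 1 T, √t * (Δ t - Δ (t + 1)) ≤ √T * (M - Δ (T + 1)) := by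
  induction T, hT using Nat.le_induction with
  | base => simpa using hΔ 1 le_rfl
  | succ T hT ih =>
    rw [Finset.sum_Icc_succ_top (by omega)]
    have := mul_le_mul_of_nonneg_right
      (Real.sqrt_le_sqrt (by exact_mod_cast T.le_succ : (T : ℝ) ≤ (T + 1 : ℕ)))
      (sub_nonneg.2 (hΔ (T + 1) (by omega)))
    linarith

theorem sum_inv_sqrt_le (T : ℕ) : ∑ t ∈ Finset.Icc 1 T, (√(t : ℝ))⁻¹ ≤ 2 * √T := by
  induction T with
  | zero => simp
  | succ T ih =>
    rw [Finset.sum_Icc_succ_top (by omega)]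
    have hpos : 0 < √((T + 1 : ℕ) : ℝ) := Real.sqrt_pos.2 (by positivity)
    have h1 : √((T + 1 : ℕ) : ℝ) ^ 2 = T + 1 := by
      rw [Real.sq_sqrt (by positivity)]; push_cast; ring
    have h2 : √(T : ℝ) ^ 2 = T := Real.sq_sqrt (by positivity)
    have h3 : (√((T + 1 : ℕ) : ℝ))⁻¹ ≤ 2 * (√((T + 1 : ℕ) : ℝ) - √T) := by
      rw [inv_le_iff_one_le_mul₀ hpos]
      nlinarith [sq_nonneg (√((T + 1 : ℕ) : ℝ) - √T)]
    linarith

theorem ProblemBounds.norm_sub_le {N p : ℕ} {P : Problem N p} {F G R : ℝ}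
    {df : ℕ → (i : Fin N) → EuclideanSpace ℝ (Fin (P.d i)) → EuclideanSpace ℝ (Fin (P.d i))}
    (hb : ProblemBounds P df F G R) (hP : ProblemAssumption P) (i : Fin N)
    {u v : EuclideanSpace ℝ (Fin (P.d i))} (hu : u ∈ P.X i) (hv : v ∈ P.X i) : ‖u - v‖ ≤ R := by
  rw [← dist_eq_norm]
  exact (Metric.dist_le_diam_of_mem (hP.compact i).isBounded hu hv).trans (hb.diam_le i)

/-- Moving the reference point within a set of diameter at most `R` changes squared distances by
at most `2 * R` times the displacement. -/
theorem norm_sub_sq_sub_norm_sub_sq_le {E : Type*} [NormedAddCommGroup E] {u v w : E} {R : ℝ}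
    (hu : ‖u - w‖ ≤ R) (hv : ‖v - w‖ ≤ R) :
    ‖u - w‖ ^ 2 - ‖v - w‖ ^ 2 ≤ 2 * R * ‖u - v‖ := by
  have h1 : ‖u - w‖ - ‖v - w‖ ≤ ‖u - v‖ := by
    simpa using norm_sub_norm_le (u - w) (v - w)
  have h2 : ‖u - w‖ ^ 2 - ‖v - w‖ ^ 2 = (‖u - w‖ + ‖v - w‖) * (‖u - w‖ - ‖v - w‖) := by ring
  rw [h2]
  calc (‖u - w‖ + ‖v - w‖) * (‖u - w‖ - ‖v - w‖) ≤ (‖u - w‖ + ‖v - w‖) * ‖u - v‖ :=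
        mul_le_mul_of_nonneg_left h1 (by positivity)
    _ ≤ 2 * R * ‖u - v‖ := mul_le_mul_of_nonneg_right (by linarith) (norm_nonneg _)

end DUST

theorem theorem1 (N p : ℕ) (a : ℝ) (ha : a ∈ Set.Ioo (0 : ℝ) 1) (B : ℕ) (hB : 0 < B)
    (F G R : ℝ) (hF : 0 < F) (hG : 0 < G) :
    ∃ C₁ C₂ : ℝ,
      ∀ (Γ : ℕ → Digraph (Fin N)) (W : ℕ → Matrix (Fin N) (Fin N) ℝ),
        DUST.NetworkAssumption Γ W a B →
      ∀ (P : DUST.Problem N p)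
        (df : ℕ → (i : Fin N) → EuclideanSpace ℝ (Fin (P.d i)) → EuclideanSpace ℝ (Fin (P.d i))),
        DUST.ProblemAssumption P → DUST.ProblemBounds P df F G R →
      ∀ (c : ℕ → Fin N → ℝ) (lam : ℕ → Fin N → EuclideanSpace ℝ (Fin p))
        (x : ℕ → P.Decision) (y μ : ℕ → Fin N → EuclideanSpace ℝ (Fin p)),
        DUST.IsRun P Γ W df (fun t => Real.sqrt t) (fun t => (t : ℝ)) c lam x y μ →
      ∀ xs : ℕ → P.Decision, P.IsOptimalSequence xs →
      ∀ T : ℕ, 1 ≤ T →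
        DUST.dynamicRegret P x xs T ≤ C₁ * Real.sqrt T + C₂ * DUST.variation P xs T := by
  refine ⟨2 * DUST.stepError N a B F G + N * R ^ 2, 2 * R, ?_⟩
  intro Γ W h P df hP hb c lam x y μ run xs hxs T hT
  have hmem : ∀ t, 1 ≤ t → ∀ i, xs t i ∈ P.X i := fun t ht => (hxs t ht).1.1
  set Φ : ℕ → ℝ := fun t => ∑ i, ‖μ t i‖ ^ 2 / c t i with hΦdef
  set Δ : ℕ → ℝ := fun t => ∑ i, ‖xs t i - x t i‖ ^ 2 with hΔdef
  have hΦ0 : ∀ t, 1 ≤ t → 0 ≤ Φ t := fun t ht =>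
    Finset.sum_nonneg fun i _ => div_nonneg (sq_nonneg _) (run.weight_pos h ha hB ht i).le
  have hΦ1 : Φ 1 = 0 := by simp [hΦdef, run.init_μ]
  have hΔ0 : ∀ t, 0 ≤ Δ t := fun t => Finset.sum_nonneg fun i _ => sq_nonneg _
  have hΔM : ∀ t, 1 ≤ t → Δ t ≤ N * R ^ 2 := by
    intro t ht
    calc Δ t ≤ ∑ _i : Fin N, R ^ 2 := Finset.sum_le_sum fun i _ =>
          pow_le_pow_left₀ (norm_nonneg _)
            (hb.norm_sub_le hP i (hmem t ht i) (run.x_mem ht i)) 2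
      _ = N * R ^ 2 := by simp
  have hstep : ∀ t ∈ Finset.Icc 1 T, ∑ i, P.f t i (x t i) - ∑ i, P.f t i (xs t i)
      ≤ (Φ t - Φ (t + 1)) / √t / 2 + DUST.stepError N a B F G * (√(t : ℝ))⁻¹
        + √t * (Δ t - Δ (t + 1)) + 2 * R * (√t * ∑ i, ‖xs (t + 1) i - xs t i‖) := by
    intro t htT
    have ht := (Finset.mem_Icc.1 htT).1
    have hs : 0 < √(t : ℝ) := Real.sqrt_pos.2 (by exact_mod_cast ht)
    have hmain := run.sqrt_mul_regret_le h ha hB hP hb hF.le ht (hxs t ht).1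
    have hmove : Δ (t + 1) - ∑ i, ‖xs t i - x (t + 1) i‖ ^ 2
        ≤ 2 * R * ∑ i, ‖xs (t + 1) i - xs t i‖ := by
      rw [← Finset.sum_sub_distrib, Finset.mul_sum]
      have hx := run.x_mem (Nat.le_succ_of_le ht)
      exact Finset.sum_le_sum fun i _ => DUST.norm_sub_sq_sub_norm_sub_sq_le
        (hb.norm_sub_le hP i (hmem _ (Nat.le_succ_of_le ht) i) (hx i))
        (hb.norm_sub_le hP i (hmem t ht i) (hx i))
    have hmove' := mul_le_mul_of_nonneg_left hmove (Nat.cast_nonneg (α := ℝ) t)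
    refine le_of_mul_le_mul_left ?_ hs
    have hexp : √(t : ℝ) * ((Φ t - Φ (t + 1)) / √t / 2 + DUST.stepError N a B F G * (√(t : ℝ))⁻¹
        + √t * (Δ t - Δ (t + 1)) + 2 * R * (√t * ∑ i, ‖xs (t + 1) i - xs t i‖))
        = (Φ t - Φ (t + 1)) / 2 + DUST.stepError N a B F G
          + √(t : ℝ) ^ 2 * (Δ t - Δ (t + 1))
          + √(t : ℝ) ^ 2 * (2 * R * ∑ i, ‖xs (t + 1) i - xs t i‖) := by
      field_simp
    rw [hexp, Real.sq_sqrt (Nat.cast_nonneg t)]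
    linarith
  have hsum := Finset.sum_le_sum hstep
  simp only [Finset.sum_add_distrib, Finset.sum_sub_distrib, ← Finset.mul_sum,
    ← Finset.sum_div] at hsum
  have h1 := DUST.sum_sub_div_sqrt_le hΦ0 hT
  have h2 := DUST.sum_sqrt_mul_sub_le hΔM hT
  have h3 := mul_le_mul_of_nonneg_left (DUST.sum_inv_sqrt_le T)
    (DUST.stepError_nonneg (N := N) (B := B) (G := G) ha hF.le)
  have h4 := div_nonneg (hΦ0 (T + 1) (by omega)) (Real.sqrt_nonneg T)
  have h5 := mul_nonneg (Real.sqrt_nonneg T) (hΔ0 (T + 1))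
  unfold DUST.dynamicRegret DUST.variation
  linarith
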